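/- Model. A non-uniform QPT machine is a family $\{\mathcal A_\lambda\}_{\lambda\in\mathbb N}$: $\mathcal A_\lambda$ holds a pure advice state $|\alpha_\lambda\rangle$, applies a quantum circuit over the gate set $\{H,T,\mathrm{CNOT}\}$ to its input and its advice, and measures designated output qubits in the computational basis; the number of advice qubits plus the number of gates is bounded by a polynomial in $\lambda$. A function is negligible if it decays faster than every inverse polynomial in $\lambda$. Let $(\mathsf{SGen},\mathsf{Sign},\mathsf{Ver})$ be a one-time signature scheme, consisting of (possibly randomized) algorithms $(\mathsf{vk},\mathsf{sk})\gets\mathsf{SGen}(1^\lambda)$, $\sigma\gets\mathsf{Sign}(\mathsf{sk},m)$ and $\mathsf{Ver}(\mathsf{vk},m,\sigma)\in\{0,1\}$, where, for each $\lambda$, the keys, messages and signatures are bit strings of fixed lengths that are polynomially bounded in $\lambda$ (nothing else about the running time of the three algorithms is needed; in particular, polynomial-time algorithms are covered). Assume that the scheme is * correct: for all $\lambda$ and all messages $m$, $\Pr[\mathsf{Ver}(\mathsf{vk},m,\mathsf{Sign}(\mathsf{sk},m))=1 : (\mathsf{vk},\mathsf{sk})\gets\mathsf{SGen}(1^\lambda)]=1$;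 and * strongly existentially unforgeable: for every QPT $\{\mathcal A_\lambda\}$ there is a negligible function $\nu$ such that for all $\lambda$ and all messages $m$, $$\Pr\left[\mathsf{Ver}(\mathsf{vk},m^*,\sigma^*)=1\text{ and }(m^*,\sigma^*)\neq(m,\sigma) : \begin{array}{l}(\mathsf{vk},\mathsf{sk})\gets\mathsf{SGen}(1^\lambda);\\ \sigma\gets\mathsf{Sign}(\mathsf{sk},m);\\ (m^*,\sigma^*)\gets\mathcal A_\lambda(\mathsf{vk},m,\sigma)\end{array}\right]\le\nu(\lambda).$$ For each $\lambda$, fix two distinct messages standing for the bits $0$ and $1$. Then the ensembles $$\left\{\frac{|0,\sigma_0\rangle+|1,\sigma_1\rangle}{\sqrt2}\,\frac{\langle 0,\sigma_0|+\langle 1,\sigma_1|}{\sqrt2},\ (\mathsf{vk}_0,\mathsf{vk}_1)\right\}_\lambda\quad\text{and}\quad\left\{\frac{|0,\sigma_0\rangle\langle 0,\sigma_0|+|1,\sigma_1\rangle\langle 1,\sigma_1|}{2},\ (\mathsf{vk}_0,\mathsf{vk}_1)\right\}_\lambda,$$ where $(\mathsf{vk}_b,\mathsf{sk}_b)\gets\mathsf{SGen}(1^\lambda)$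 and $\sigma_b\gets\mathsf{Sign}(\mathsf{sk}_b,b)$ independently for $b\in\{0,1\}$, are computationally indistinguishable: for every QPT $\{\mathcal A_\lambda\}$ with one output bit, the absolute difference of the probabilities that $\mathcal A_\lambda$ outputs $1$ on the two ensembles is a negligible function of $\lambda$. -/

import Mathlib

namespace QOTS

/-! ### Bit strings, qubits and states -/

/-- Bit strings of length `n`. -/
abbrev BitStr (n : ℕ) : Type := Fin n → Bool

/-- Operators on the qubits labelled by `Q`, written in the computational basis `Q → Bool`. -/
abbrev Op (Q : Type) : Type := Matrix (Q → Bool) (Q → Bool) ℂ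

section Quantum

variable {Q R : Type} [Fintype Q] [DecidableEq Q] [Fintype R] [DecidableEq R]

/-- The computational basis vector `|x⟩`. -/
def ket (x : Q → Bool) : (Q → Bool) → ℂ := Pi.single x 1

/-- The rank-one operator `|ψ⟩⟨ψ|`. -/
def proj (ψ : (Q → Bool) → ℂ) : Op Q := Matrix.vecMulVec ψ (star ψ)

/-- The tensor product of an operator on the qubits `Q` and an operator on the qubits `R`. -/
def tensor (ρ : Op Q) (τ : Op R) : Op (Q ⊕ R) :=
  Matrix.of fun y x =>
    ρ (fun i => y (Sum.inl i)) (fun i => x (Sum.inl i)) *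
      τ (fun j => y (Sum.inr j)) (fun j => x (Sum.inr j))

/-! ### Quantum circuits over the universal gate set `{H, T, CNOT}` -/

/-- Elementary gates on the qubits `Q`; `CNOT c t` has control `c` and target `t`. -/
inductive Gate (Q : Type) : Type
  | H (i : Q)
  | T (i : Q)
  | CNOT (c t : Q) (h : c ≠ t)

/-- The one-qubit operator `u`, applied to qubit `i`. -/
noncomputable def onQubit (i : Q) (u : Matrix Bool Bool ℂ) : Op Q :=
  Matrix.of fun y x => if ∀ j, j ≠ i → y j = x j then u (y i) (x i) else 0

/-- The unitary of a gate (entry `y x` is `⟨y| U |x⟩`). -/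
noncomputable def Gate.unitary : Gate Q → Op Q
  | .H i => onQubit i
      (Matrix.of fun b a => ((1 / Real.sqrt 2 : ℝ) : ℂ) * (if a && b then -1 else 1))
  | .T i => onQubit i
      (Matrix.diagonal fun a => if a then Complex.exp (Real.pi / 4 * Complex.I) else 1)
  | .CNOT c t _ =>
      Matrix.of fun y x => if y = Function.update x t (xor (x t) (x c)) then 1 else 0

/-- A circuit is a list of gates; the head of the list is applied first. -/
abbrev Circuit (Q : Type) : Type := List (Gate Q)

/-- The unitary computed by a circuit. -/
noncomputable def circuitUnitary : Circuit Q → Op Q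
  | [] => 1
  | g :: c => circuitUnitary c * g.unitary

end Quantum

/-! ### Non-uniform quantum polynomial-time machines -/

/-- A quantum machine with input qubits `I` and output bits `O`: it holds an advice state on
`anc` further qubits, runs a circuit on input and advice, and measures the qubits `out` in the
computational basis. -/
structure QMachine (I O : Type) where
  anc : ℕ
  advice : BitStr anc → ℂ
  advice_unit : ∑ a, ‖advice a‖ ^ 2 = 1
  circuit : Circuit (I ⊕ Fin anc)
  out : O ↪ I ⊕ Fin anc

namespace QMachine

variable {I O : Type} [Fintype I] [DecidableEq I] [Fintype O] [DecidableEq O]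

/-- Size of a machine: number of advice qubits plus number of gates. -/
def size (A : QMachine I O) : ℕ := A.anc + A.circuit.length

/-- The state of the machine just before the measurement, on the input state `ρ`. -/
noncomputable def finalState (A : QMachine I O) (ρ : Op I) : Op (I ⊕ Fin A.anc) :=
  circuitUnitary A.circuit * tensor ρ (proj A.advice) * (circuitUnitary A.circuit).conjTranspose

/-- The projector onto the outcome `y` of the measurement of the output qubits. -/
def outcome (A : QMachine I O) (y : O → Bool) : Op (I ⊕ Fin A.anc) :=
  Matrix.diagonal fun x => if (fun o => x (A.out o)) = y then 1 else 0

/-- The probability that the machine outputs `y` on the input state `ρ`. -/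
noncomputable def outProb (A : QMachine I O) (ρ : Op I) (y : O → Bool) : ℝ :=
  (Matrix.trace (A.outcome y * A.finalState ρ)).re

end QMachine

/-- A family of quantum machines, indexed by the security parameter, is QPT if its size is
bounded by a polynomial. -/
def IsQPT {I O : ℕ → Type} (A : ∀ n, QMachine (I n) (O n)) : Prop :=
  ∃ p : Polynomial ℕ, ∀ n, (A n).size ≤ p.eval n

/-- Negligible functions: they decay faster than every inverse polynomial. -/
def Negligible (f : ℕ → ℝ) : Prop :=
  Asymptotics.SuperpolynomialDecay Filter.atTop (fun n : ℕ => (n : ℝ)) f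

/-- Computational indistinguishability of two ensembles of (density operators of) quantum
states: every QPT machine with one output bit has negligible distinguishing advantage. -/
def CompIndist {Q : ℕ → Type} [∀ n, Fintype (Q n)] [∀ n, DecidableEq (Q n)]
    (ρ τ : ∀ n, Op (Q n)) : Prop :=
  ∀ A : ∀ n, QMachine (Q n) Unit, IsQPT (I := Q) (O := fun _ => Unit) A →
    Negligible fun n =>
      |(A n).outProb (ρ n) (fun _ => true) - (A n).outProb (τ n) (fun _ => true)|

/-! ### One-time signatures -/

/-- A one-time signature scheme; `n` is the security parameter. The three algorithms may be
randomized; keys, messages and signatures are bit strings of polynomial length. The algorithms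
themselves are arbitrary: in particular, polynomial-time ones are covered. -/
structure OTS where
  vkLen : ℕ → ℕ
  skLen : ℕ → ℕ
  msgLen : ℕ → ℕ
  sigLen : ℕ → ℕ
  poly_len : ∃ p : Polynomial ℕ, ∀ n, vkLen n + skLen n + msgLen n + sigLen n ≤ p.eval n
  gen : ∀ n, PMF (BitStr (vkLen n) × BitStr (skLen n))
  sign : ∀ n, BitStr (skLen n) → BitStr (msgLen n) → PMF (BitStr (sigLen n))
  ver : ∀ n, BitStr (vkLen n) → BitStr (msgLen n) → BitStr (sigLen n) → PMF Bool

namespace OTS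

variable (S : OTS)

/-- Honest signatures are accepted with probability one. -/
def Correct : Prop :=
  ∀ n (m : BitStr (S.msgLen n)),
    ((S.gen n).bind fun k => (S.sign n k.2 m).bind fun σ => S.ver n k.1 m σ) true = 1

/-- The joint distribution of `(vk, σ)` for `(vk, sk) ← gen`, `σ ← sign sk m`. -/
noncomputable def signed (n : ℕ) (m : BitStr (S.msgLen n)) :
    PMF (BitStr (S.vkLen n) × BitStr (S.sigLen n)) :=
  (S.gen n).bind fun k => (S.sign n k.2 m).map fun σ => (k.1, σ)

/-- Input register `(vk, m, σ)` of a forger. -/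
abbrev ForgeIn (n : ℕ) : Type := Fin (S.vkLen n) ⊕ (Fin (S.msgLen n) ⊕ Fin (S.sigLen n))

/-- Output register `(m*, σ*)` of a forger. -/
abbrev ForgeOut (n : ℕ) : Type := Fin (S.msgLen n) ⊕ Fin (S.sigLen n)

/-- The probability that the forger `A`, on input `(vk, m, σ)`, outputs `(m*, σ*) ≠ (m, σ)`
with `ver vk m* σ* = 1`. -/
noncomputable def forgeProb (n : ℕ) (A : QMachine (S.ForgeIn n) (S.ForgeOut n))
    (m : BitStr (S.msgLen n)) : ℝ :=
  ∑ k : BitStr (S.vkLen n) × BitStr (S.sigLen n), (S.signed n m k).toReal *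
    ∑ f : BitStr (S.msgLen n) × BitStr (S.sigLen n),
      if f = (m, k.2) then 0 else
        A.outProb (proj (ket (Sum.elim k.1 (Sum.elim m k.2)))) (Sum.elim f.1 f.2) *
          (S.ver n k.1 f.1 f.2 true).toReal

/-- (Quantum-secure) strong existential unforgeability. -/
def StronglyUnforgeable : Prop :=
  ∀ A : ∀ n, QMachine (S.ForgeIn n) (S.ForgeOut n), IsQPT (I := S.ForgeIn) (O := S.ForgeOut) A →
    ∃ ν : ℕ → ℝ, Negligible ν ∧ ∀ n (m : BitStr (S.msgLen n)), S.forgeProb n (A n) m ≤ ν n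

/-! ### Signature states -/

/-- The quantum register, holding a bit and a signature. -/
abbrev SigReg (n : ℕ) : Type := Unit ⊕ Fin (S.sigLen n)

/-- The register holding the two verification keys. -/
abbrev KeyReg (n : ℕ) : Type := Fin (S.vkLen n) ⊕ Fin (S.vkLen n)

variable {S} in
/-- The basis state `|b, σ⟩`. -/
def sigKet {n : ℕ} (b : Bool) (σ : BitStr (S.sigLen n)) : (S.SigReg n → Bool) → ℂ :=
  ket (Sum.elim (fun _ => b) σ)

/-- The state of `(ρ(σ₀, σ₁), (vk₀, vk₁))` averaged over independent
`(vk_b, sk_b) ← gen`, `σ_b ← sign sk_b b`; here `bit b` is the message that stands for `b`. -/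
noncomputable def ensemble (bit : ∀ n, Bool ↪ BitStr (S.msgLen n))
    (ρ : ∀ n, BitStr (S.sigLen n) → BitStr (S.sigLen n) → Op (S.SigReg n)) (n : ℕ) :
    Op (S.SigReg n ⊕ S.KeyReg n) :=
  ∑ k₀ : BitStr (S.vkLen n) × BitStr (S.sigLen n),
    ∑ k₁ : BitStr (S.vkLen n) × BitStr (S.sigLen n),
      (((S.signed n (bit n false) k₀).toReal * (S.signed n (bit n true) k₁).toReal : ℝ) : ℂ) •
        tensor (ρ n k₀.2 k₁.2) (proj (ket (Sum.elim k₀.1 k₁.1)))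

/-- The projector onto `(|0, σ₀⟩ + |1, σ₁⟩) / √2`. -/
noncomputable def superposition (n : ℕ) (σ₀ σ₁ : BitStr (S.sigLen n)) : Op (S.SigReg n) :=
  proj (((1 / Real.sqrt 2 : ℝ) : ℂ) • (sigKet false σ₀ + sigKet true σ₁))

/-- The mixture `(|0, σ₀⟩⟨0, σ₀| + |1, σ₁⟩⟨1, σ₁|) / 2`. -/
noncomputable def mixture (n : ℕ) (σ₀ σ₁ : BitStr (S.sigLen n)) : Op (S.SigReg n) :=
  (1 / 2 : ℂ) • (proj (sigKet false σ₀) + proj (sigKet true σ₁))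

end OTS

end QOTS

open scoped Matrix
set_option linter.unusedSectionVars false

namespace QOTS

section Gates

variable {Q R : Type} [Fintype Q] [DecidableEq Q] [Fintype R] [DecidableEq R]

/-! ### Action of gates on state vectors -/

/-! Distinguishing the superposition from the mixture requires mapping one branch to the other, and
such a map is a forger. Fix keys and signatures, let `U` be the distinguisher's circuit and `Π` its
accepting projector. The cross terms of the superposition are all that separates the two acceptance
probabilities, so the gap is `Re ⟨1,σ₁|U†ΠU|0,σ₀⟩`, keys and advice understood
(`outProb_superposition_sub_mixture`). The branches are orthogonal, so the reflection `U†(1 - 2Π)U`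
has matrix element `-2⟨1,σ₁|U†ΠU|0,σ₀⟩` between them (`dotProduct_reflection`). Applying it to
`|0,σ₀⟩` and measuring therefore yields `σ₁` with probability at least the squared gap.

The forger holds `(vk₀,σ₀)` as advice, uses its challenge key as `vk₁`, and ignores the signature it
receives on message 0. Since the law of `vk₁` does not depend on the message signed, and correctness
makes an honest `σ₁` acceptable, it outputs a valid signature on message 1 with probability at least
the mean squared overlap (`sum_norm_overlap_sq_le_forgeProb`). Fixing the best `(vk₀,σ₀)` and
applying Jensen over `(vk₁,σ₁)` bounds the squared advantage by the forging probability
(`exists_sq_advantage_le_forgeProb`); the square root of a negligible function is negligible. -/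

theorem onQubit_mulVec (i : Q) (u : Matrix Bool Bool ℂ) (ψ : (Q → Bool) → ℂ) (y : Q → Bool) :
    (onQubit i u *ᵥ ψ) y = ∑ b, u (y i) b * ψ (Function.update y i b) := by
  symm
  refine Fintype.sum_of_injective (fun b => Function.update y i b)
    (Function.update_injective y i) _ _ ?_ ?_
  · intro x hx
    have : ¬ ∀ j, j ≠ i → y j = x j := fun h => hx ⟨x i, by
      funext j
      by_cases hj : j = i
      · subst hj; simp
      · simp [hj, h j hj]⟩
    simp only [onQubit, Matrix.of_apply, if_neg this, zero_mul]
  · intro b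
    have : ∀ j, j ≠ i → y j = Function.update y i b j := fun j hj => by simp [hj]
    simp only [onQubit, Matrix.of_apply, if_pos this, Function.update_self]

theorem CNOT_mulVec (c t : Q) (h : c ≠ t) (ψ : (Q → Bool) → ℂ) (y : Q → Bool) :
    ((Gate.CNOT c t h).unitary *ᵥ ψ) y = ψ (Function.update y t (xor (y t) (y c))) := by
  have key : ∀ x : Q → Bool, y = Function.update x t (xor (x t) (x c)) ↔
      x = Function.update y t (xor (y t) (y c)) := by
    intro x
    constructor <;> rintro rfl <;> funext j <;> by_cases hj : j = t <;> simp_all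
  simp [Gate.unitary, Matrix.mulVec, dotProduct, key]

theorem onQubit_mul (i : Q) (u v : Matrix Bool Bool ℂ) :
    onQubit i u * onQubit i v = onQubit i (u * v) := by
  apply Matrix.mulVec_injective
  funext ψ y
  simp only [← Matrix.mulVec_mulVec, onQubit_mulVec, Matrix.mul_apply, Function.update_self,
    Function.update_idem, Finset.mul_sum, Finset.sum_mul]
  rw [Finset.sum_comm]
  simp only [mul_assoc]

theorem onQubit_one (i : Q) : onQubit i 1 = 1 := by
  apply Matrix.mulVec_injective
  funext ψ y
  simp [onQubit_mulVec, Matrix.one_apply]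

theorem conjTranspose_onQubit (i : Q) (u : Matrix Bool Bool ℂ) :
    (onQubit i u)ᴴ = onQubit i uᴴ := by
  ext y x
  have : (∀ j, j ≠ i → x j = y j) ↔ ∀ j, j ≠ i → y j = x j :=
    forall₂_congr fun _ _ => eq_comm
  simp only [Matrix.conjTranspose_apply, onQubit, Matrix.of_apply, this]
  split_ifs <;> simp

/-! ### Inverse circuits -/

theorem circuitUnitary_append (c d : Circuit Q) :
    circuitUnitary (c ++ d) = circuitUnitary d * circuitUnitary c := by
  induction c with
  | nil => simp [circuitUnitary]
  | cons g c ih => simp [circuitUnitary, ih, mul_assoc]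

/-- The one-qubit matrix of the `T` gate. -/
noncomputable def tMatrix : Matrix Bool Bool ℂ :=
  Matrix.diagonal fun a => if a then Complex.exp (Real.pi / 4 * Complex.I) else 1

theorem circuitUnitary_replicate_T (i : Q) (k : ℕ) :
    circuitUnitary (List.replicate k (Gate.T i)) = onQubit i (tMatrix ^ k) := by
  induction k with
  | zero => simp [circuitUnitary, onQubit_one]
  | succ k ih =>
    rw [List.replicate_succ, circuitUnitary, ih, pow_succ, ← onQubit_mul]
    rfl

theorem tMatrix_pow (k : ℕ) :
    tMatrix ^ k = Matrix.diagonal fun a => if a then Complex.exp (k * (Real.pi / 4 * Complex.I))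
      else 1 := by
  rw [tMatrix, Matrix.diagonal_pow]
  congr 1
  funext a
  cases a <;> simp [Complex.exp_nat_mul]

/-- `T⁴` is the Pauli `Z`, which supplies the sign flip of the reflection within the gate set. -/
theorem tMatrix_pow_four :
    tMatrix ^ 4 = Matrix.diagonal fun a => if a then -1 else 1 := by
  rw [tMatrix_pow]
  congr 1
  funext a
  have : ((4 : ℕ) : ℂ) * (Real.pi / 4 * Complex.I) = Real.pi * Complex.I := by push_cast; ring
  rw [this, Complex.exp_pi_mul_I]

theorem tMatrix_pow_eight : tMatrix ^ 8 = 1 := by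
  rw [show 8 = 4 + 4 from rfl, pow_add, tMatrix_pow_four, Matrix.diagonal_mul_diagonal,
    ← Matrix.diagonal_one]
  congr 1
  funext a
  cases a <;> simp

/-- `T` has order dividing eight, so its inverse costs seven gates; this is the factor 7 in
`length_inverseCircuit_le`. -/
theorem conjTranspose_tMatrix : tMatrixᴴ = tMatrix ^ 7 := by
  rw [tMatrix_pow, tMatrix, Matrix.diagonal_conjTranspose]
  congr 1
  funext a
  cases a
  · simp
  · have : ((7 : ℕ) : ℂ) * (Real.pi / 4 * Complex.I)
        = -(Real.pi / 4 * Complex.I) + 2 * Real.pi * Complex.I := by push_cast; ring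
    simp only [Pi.star_apply, if_true, this, Complex.exp_add, Complex.exp_two_pi_mul_I, mul_one]
    rw [Complex.star_def, ← Complex.exp_conj]
    simp [map_ofNat]

/-- A circuit for the inverse of a gate. -/
def Gate.inverse : Gate Q → Circuit Q
  | .H i => [.H i]
  | .T i => List.replicate 7 (.T i)
  | .CNOT c t h => [.CNOT c t h]

theorem Gate.length_inverse_le (g : Gate Q) : g.inverse.length ≤ 7 := by
  cases g <;> simp [Gate.inverse]

theorem circuitUnitary_gate_inverse (g : Gate Q) :
    circuitUnitary g.inverse = g.unitaryᴴ := by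
  cases g with
  | H i =>
    simp only [Gate.inverse, circuitUnitary, one_mul, Gate.unitary, conjTranspose_onQubit]
    congr 1
    ext b a
    cases a <;> cases b <;> simp
  | T i =>
    rw [Gate.inverse, circuitUnitary_replicate_T, ← conjTranspose_tMatrix,
      ← conjTranspose_onQubit]
    rfl
  | CNOT c t h =>
    have key : ∀ x y : Q → Bool, y = Function.update x t (xor (x t) (x c)) ↔
        x = Function.update y t (xor (y t) (y c)) := by
      intro x y
      constructor <;> rintro rfl <;> funext j <;> by_cases hj : j = t <;> simp_all
    ext y x
    simp only [Gate.inverse, circuitUnitary, one_mul, Gate.unitary, Matrix.of_apply,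
      Matrix.conjTranspose_apply, key x y]
    split_ifs <;> simp

theorem Gate.conjTranspose_mul_self (g : Gate Q) : g.unitaryᴴ * g.unitary = 1 := by
  cases g with
  | H i =>
    rw [Gate.unitary, conjTranspose_onQubit, onQubit_mul, ← onQubit_one i]
    congr 1
    have h2 : ((Real.sqrt 2 : ℝ) : ℂ) * ((Real.sqrt 2 : ℝ) : ℂ) = 2 := by
      rw [← Complex.ofReal_mul, Real.mul_self_sqrt (by norm_num)]; norm_num
    have h3 : ((Real.sqrt 2 : ℝ) : ℂ)⁻¹ * ((Real.sqrt 2 : ℝ) : ℂ)⁻¹ = 1 / 2 := by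
      rw [← mul_inv, h2]; norm_num
    ext b a
    cases a <;> cases b <;> norm_num [Matrix.mul_apply, h3]
  | T i =>
    change (onQubit i tMatrix)ᴴ * onQubit i tMatrix = 1
    rw [conjTranspose_onQubit, onQubit_mul, conjTranspose_tMatrix, ← pow_succ, tMatrix_pow_eight,
      onQubit_one]
  | CNOT c t h =>
    rw [← circuitUnitary_gate_inverse]
    simp only [Gate.inverse, circuitUnitary, one_mul]
    apply Matrix.mulVec_injective
    funext ψ y
    rw [← Matrix.mulVec_mulVec, CNOT_mulVec, CNOT_mulVec]
    simp [h]

theorem conjTranspose_circuitUnitary_mul_self (c : Circuit Q) :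
    (circuitUnitary c)ᴴ * circuitUnitary c = 1 := by
  induction c with
  | nil => simp [circuitUnitary]
  | cons g c ih =>
    rw [circuitUnitary, Matrix.conjTranspose_mul, mul_assoc,
      ← mul_assoc (circuitUnitary c)ᴴ, ih, one_mul, g.conjTranspose_mul_self]

/-- A circuit for the inverse of a circuit. -/
def inverseCircuit : Circuit Q → Circuit Q
  | [] => []
  | g :: c => inverseCircuit c ++ g.inverse

theorem length_inverseCircuit_le (c : Circuit Q) : (inverseCircuit c).length ≤ 7 * c.length := by
  induction c with
  | nil => simp [inverseCircuit]
  | cons g c ih =>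
    have := g.length_inverse_le
    simp only [inverseCircuit, List.length_append, List.length_cons]
    omega

theorem circuitUnitary_inverseCircuit (c : Circuit Q) :
    circuitUnitary (inverseCircuit c) = (circuitUnitary c)ᴴ := by
  induction c with
  | nil => simp [circuitUnitary, inverseCircuit]
  | cons g c ih =>
    rw [inverseCircuit, circuitUnitary_append, ih, circuitUnitary_gate_inverse, circuitUnitary,
      Matrix.conjTranspose_mul]

/-! ### Circuits on a subset of the qubits -/

/-- Relabelling of the qubits of a gate. -/
def Gate.map (e : Q ↪ R) : Gate Q → Gate R
  | .H i => .H (e i)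
  | .T i => .T (e i)
  | .CNOT c t h => .CNOT (e c) (e t) (e.injective.ne h)

open Classical in
/-- The state `ψ` on the qubits in the range of `e`, all other qubits being in the basis state
given by `r`. -/
noncomputable def embed (e : Q ↪ R) (r : R → Bool) (ψ : (Q → Bool) → ℂ) : (R → Bool) → ℂ :=
  fun y => if ∀ j ∉ Set.range e, y j = r j then ψ (y ∘ e) else 0

/-- A change at a qubit in the range of `e` cannot affect the frozen qubits. This is why relabelled
gates commute with `embed`. -/
theorem embed_update (e : Q ↪ R) (r : R → Bool) (ψ : (Q → Bool) → ℂ) (y : R → Bool) (i : Q)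
    (b : Bool) : embed e r ψ (Function.update y (e i) b) =
      embed e r (fun q => ψ (Function.update q i b)) y := by
  have : (∀ j ∉ Set.range e, Function.update y (e i) b j = r j) ↔
      ∀ j ∉ Set.range e, y j = r j := by
    refine forall₂_congr fun j hj => ?_
    rw [Function.update_of_ne]
    rintro rfl
    exact hj ⟨i, rfl⟩
  simp only [embed, this, Function.update_comp_eq_of_injective y e.injective]

theorem onQubit_mulVec_embed (e : Q ↪ R) (r : R → Bool) (i : Q) (u : Matrix Bool Bool ℂ)
    (ψ : (Q → Bool) → ℂ) :
    onQubit (e i) u *ᵥ embed e r ψ = embed e r (onQubit i u *ᵥ ψ) := by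
  funext y
  simp only [onQubit_mulVec, embed_update]
  simp only [embed, onQubit_mulVec]
  split_ifs <;> simp

theorem Gate.map_unitary_mulVec_embed (e : Q ↪ R) (r : R → Bool) (g : Gate Q)
    (ψ : (Q → Bool) → ℂ) :
    (g.map e).unitary *ᵥ embed e r ψ = embed e r (g.unitary *ᵥ ψ) := by
  cases g with
  | H i => exact onQubit_mulVec_embed e r i _ ψ
  | T i => exact onQubit_mulVec_embed e r i _ ψ
  | CNOT c t h =>
    funext y
    rw [Gate.map, CNOT_mulVec, embed_update]
    simp only [embed, CNOT_mulVec, Function.comp_apply]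

theorem circuitUnitary_map_mulVec_embed (e : Q ↪ R) (r : R → Bool) (c : Circuit Q)
    (ψ : (Q → Bool) → ℂ) :
    circuitUnitary (c.map (Gate.map e)) *ᵥ embed e r ψ = embed e r (circuitUnitary c *ᵥ ψ) := by
  induction c generalizing ψ with
  | nil => simp [circuitUnitary]
  | cons g c ih =>
    rw [List.map_cons, circuitUnitary, circuitUnitary, ← Matrix.mulVec_mulVec,
      g.map_unitary_mulVec_embed, ih, Matrix.mulVec_mulVec]

theorem embed_extend (e : Q ↪ R) (r : R → Bool) (ψ : (Q → Bool) → ℂ) (q : Q → Bool) :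
    embed e r ψ (Function.extend e q r) = ψ q := by
  have h : ∀ j ∉ Set.range e, Function.extend e q r j = r j := fun j hj =>
    Function.extend_apply' _ _ _ (by simpa using hj)
  have h' : Function.extend e q r ∘ e = q := funext fun i => e.injective.extend_apply _ _ _
  rw [embed, if_pos h, h']

/-! ### Products of state vectors -/

/-- The tensor product of state vectors. -/
def tensorVec (v : (Q → Bool) → ℂ) (w : (R → Bool) → ℂ) : (Q ⊕ R → Bool) → ℂ :=
  fun x => v (fun i => x (Sum.inl i)) * w (fun j => x (Sum.inr j))

theorem tensor_proj_proj (v : (Q → Bool) → ℂ) (w : (R → Bool) → ℂ) :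
    tensor (proj v) (proj w) = proj (tensorVec v w) := by
  ext y x
  simp only [tensor, proj, Matrix.of_apply, Matrix.vecMulVec_apply, tensorVec, Pi.star_apply,
    star_mul']
  ring

theorem sum_norm_sq_tensorVec (v : (Q → Bool) → ℂ) (w : (R → Bool) → ℂ) :
    ∑ x, ‖tensorVec v w x‖ ^ 2 = (∑ x, ‖v x‖ ^ 2) * ∑ x, ‖w x‖ ^ 2 := by
  rw [Finset.sum_mul_sum, ← Fintype.sum_prod_type']
  refine Fintype.sum_equiv (Equiv.sumArrowEquivProdArrow Q R Bool) _ _ fun x => ?_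
  simp only [tensorVec, norm_mul, mul_pow]
  rfl

theorem sum_norm_sq_ket (x : Q → Bool) : ∑ y, ‖ket x y‖ ^ 2 = 1 := by
  rw [Fintype.sum_eq_single x]
  · simp [ket]
  · intro y hy
    simp [ket, hy]

theorem tensorVec_ket_ket (x : Q → Bool) (z : R → Bool) :
    tensorVec (ket x) (ket z) = ket (Sum.elim x z) := by
  funext y
  have : y = Sum.elim x z ↔ (fun i => y (Sum.inl i)) = x ∧ (fun j => y (Sum.inr j)) = z := by
    simp [funext_iff]
  simp only [tensorVec, ket, Pi.single_apply, this]
  split_ifs <;> simp_all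

end Gates

/-! ### Linearity of tensor products in the left factor. -/

section Linearity

variable {Q R : Type} [Fintype Q] [DecidableEq Q] [Fintype R] [DecidableEq R]

theorem tensor_smul_left (c : ℂ) (ρ : Op Q) (τ : Op R) : tensor (c • ρ) τ = c • tensor ρ τ := by
  ext y x
  simp [tensor, mul_assoc]

theorem tensor_add_left (ρ ρ' : Op Q) (τ : Op R) :
    tensor (ρ + ρ') τ = tensor ρ τ + tensor ρ' τ := by
  ext y x
  simp [tensor, add_mul]

theorem tensorVec_smul_left (c : ℂ) (v : (Q → Bool) → ℂ) (w : (R → Bool) → ℂ) :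
    tensorVec (c • v) w = c • tensorVec v w := by
  funext x
  simp [tensorVec, mul_assoc]

theorem tensorVec_add_left (v v' : (Q → Bool) → ℂ) (w : (R → Bool) → ℂ) :
    tensorVec (v + v') w = tensorVec v w + tensorVec v' w := by
  funext x
  simp [tensorVec, add_mul]

end Linearity

namespace QMachine

variable {I O : Type} [Fintype I] [DecidableEq I] [Fintype O] [DecidableEq O]

/-! ### Output probabilities -/

theorem outProb_add (A : QMachine I O) (ρ τ : Op I) (y : O → Bool) :
    A.outProb (ρ + τ) y = A.outProb ρ y + A.outProb τ y := by
  simp [outProb, finalState, tensor_add_left, mul_add, add_mul]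

theorem outProb_smul (A : QMachine I O) (c : ℝ) (ρ : Op I) (y : O → Bool) :
    A.outProb ((c : ℂ) • ρ) y = c * A.outProb ρ y := by
  simp [outProb, finalState, tensor_smul_left, -Complex.coe_smul]

theorem outProb_sum {ι : Type*} (A : QMachine I O) (s : Finset ι) (ρ : ι → Op I) (y : O → Bool) :
    A.outProb (∑ i ∈ s, ρ i) y = ∑ i ∈ s, A.outProb (ρ i) y :=
  map_sum (AddMonoidHom.mk' (fun ρ => A.outProb ρ y) fun ρ τ => A.outProb_add ρ τ y) ρ s

/-- The state vector just before the measurement, on the input state vector `χ`. -/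
noncomputable def finalVec (A : QMachine I O) (χ : (I → Bool) → ℂ) :
    (I ⊕ Fin A.anc → Bool) → ℂ :=
  circuitUnitary A.circuit *ᵥ tensorVec χ A.advice

theorem finalVec_smul (A : QMachine I O) (c : ℂ) (χ : (I → Bool) → ℂ) :
    A.finalVec (c • χ) = c • A.finalVec χ := by
  rw [finalVec, finalVec, tensorVec_smul_left, Matrix.mulVec_smul]

theorem finalVec_add (A : QMachine I O) (χ ξ : (I → Bool) → ℂ) :
    A.finalVec (χ + ξ) = A.finalVec χ + A.finalVec ξ := by
  rw [finalVec, finalVec, finalVec, tensorVec_add_left, Matrix.mulVec_add]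

theorem finalState_proj (A : QMachine I O) (χ : (I → Bool) → ℂ) :
    A.finalState (proj χ) = proj (A.finalVec χ) := by
  rw [finalState, tensor_proj_proj, proj, proj, Matrix.mul_vecMulVec, Matrix.vecMulVec_mul,
    finalVec, Matrix.star_mulVec]

theorem outProb_proj (A : QMachine I O) (χ : (I → Bool) → ℂ) (y : O → Bool) :
    A.outProb (proj χ) y =
      ∑ x, if (fun o => x (A.out o)) = y then ‖A.finalVec χ x‖ ^ 2 else 0 := by
  rw [outProb, finalState_proj, Matrix.trace, Complex.re_sum]
  refine Finset.sum_congr rfl fun x _ => ?_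
  rw [Matrix.diag_apply, outcome, Matrix.diagonal_mul, proj, Matrix.vecMulVec_apply]
  split_ifs
  · rw [one_mul, Pi.star_apply, Complex.star_def, Complex.mul_conj, Complex.ofReal_re,
      Complex.normSq_eq_norm_sq]
  · simp

/-- The gap between the superposition and the mixture of two states is an interference term. -/
theorem outProb_superposition_sub_mixture (A : QMachine I O) (χ ξ : (I → Bool) → ℂ)
    (y : O → Bool) :
    A.outProb (proj (((1 / Real.sqrt 2 : ℝ) : ℂ) • (χ + ξ))) y -
        A.outProb ((1 / 2 : ℂ) • (proj χ + proj ξ)) y =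
      (star (A.finalVec ξ) ⬝ᵥ (A.outcome y *ᵥ A.finalVec χ)).re := by
  have h : (1 / 2 : ℂ) = ((1 / 2 : ℝ) : ℂ) := by norm_num
  have h2 : (1 / Real.sqrt 2) ^ 2 = 1 / 2 := by
    rw [div_pow, Real.sq_sqrt (by norm_num), one_pow]
  rw [h, outProb_smul, outProb_add]
  simp only [outProb_proj, finalVec_smul, finalVec_add]
  rw [← Finset.sum_add_distrib, Finset.mul_sum, ← Finset.sum_sub_distrib, dotProduct,
    Complex.re_sum]
  refine Finset.sum_congr rfl fun x _ => ?_
  simp only [outcome, Matrix.mulVec_diagonal]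
  split_ifs
  -- Pointwise identity: `|(a + b)/√2|² - (|a|² + |b|²)/2 = Re(conj b * a)`.
  · rw [Pi.smul_apply, Pi.add_apply, smul_eq_mul, norm_mul, mul_pow, Complex.norm_real,
      Real.norm_eq_abs, sq_abs, h2]
    simp only [← Complex.normSq_eq_norm_sq, Complex.normSq_apply, Pi.star_apply, Complex.star_def,
      Complex.add_re, Complex.add_im, one_mul, Complex.mul_re, Complex.conj_re, Complex.conj_im]
    ring
  · simp

/-! ### Reflection about the accepting subspace -/

/-- Run the machine, flip the sign of the accepting branch, and run the machine backwards. -/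
def reflection (A : QMachine I Unit) : Circuit (I ⊕ Fin A.anc) :=
  A.circuit ++ (List.replicate 4 (Gate.T (A.out ())) ++ inverseCircuit A.circuit)

theorem length_reflection_le (A : QMachine I Unit) :
    A.reflection.length ≤ 8 * A.circuit.length + 4 := by
  have := length_inverseCircuit_le A.circuit
  simp only [reflection, List.length_append, List.length_replicate]
  omega

/-- With a single output bit, acceptance is the value of one qubit, so `Z` on that qubit is the
reflection `1 - 2Π`. -/
theorem onQubit_out (A : QMachine I Unit) :
    onQubit (A.out ()) (Matrix.diagonal fun a => if a then -1 else 1) =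
      1 - (2 : ℂ) • A.outcome fun _ => true := by
  apply Matrix.mulVec_injective
  funext ψ y
  rw [onQubit_mulVec, Matrix.sub_mulVec, Matrix.one_mulVec, Matrix.smul_mulVec, Pi.sub_apply,
    Pi.smul_apply, outcome, Matrix.mulVec_diagonal]
  have h : Function.update y (A.out ()) (y (A.out ())) = y := Function.update_eq_self _ _
  have h' : ((fun o => y (A.out o)) = fun _ => true) ↔ y (A.out ()) = true :=
    ⟨fun h => congrFun h (), fun h => funext fun _ => h⟩
  simp only [h']
  rw [Fintype.sum_eq_single (y (A.out ())) (fun b hb => by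
    rw [Matrix.diagonal_apply_ne _ hb.symm, zero_mul]), h, Matrix.diagonal_apply_eq]
  split_ifs
  · simp; ring
  · simp

theorem circuitUnitary_reflection (A : QMachine I Unit) :
    circuitUnitary A.reflection = (circuitUnitary A.circuit)ᴴ *
      (1 - (2 : ℂ) • A.outcome fun _ => true) * circuitUnitary A.circuit := by
  rw [reflection, circuitUnitary_append, circuitUnitary_append, circuitUnitary_inverseCircuit,
    circuitUnitary_replicate_T, tMatrix_pow_four, onQubit_out]

/-- The identity part of the reflection contributes `⟨ξ|U†U|χ⟩ = ⟨ξ|χ⟩ = 0`; only the `-2Π` part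
survives. -/
theorem dotProduct_reflection (A : QMachine I Unit) (χ ξ : (I → Bool) → ℂ)
    (h : star (tensorVec ξ A.advice) ⬝ᵥ tensorVec χ A.advice = 0) :
    star (tensorVec ξ A.advice) ⬝ᵥ (circuitUnitary A.reflection *ᵥ tensorVec χ A.advice) =
      -2 * (star (A.finalVec ξ) ⬝ᵥ ((A.outcome fun _ => true) *ᵥ A.finalVec χ)) := by
  rw [circuitUnitary_reflection, mul_sub, sub_mul, mul_one, conjTranspose_circuitUnitary_mul_self,
    Matrix.sub_mulVec, Matrix.one_mulVec, dotProduct_sub, h, finalVec, finalVec,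
    Matrix.star_mulVec, ← Matrix.mulVec_mulVec, ← Matrix.mulVec_mulVec, Matrix.dotProduct_mulVec,
    Matrix.smul_mulVec, dotProduct_smul, smul_eq_mul]
  ring

theorem sum_norm_sq_tensorVec_ket_advice (A : QMachine I O) (z : I → Bool) :
    ∑ q, ‖tensorVec (ket z) A.advice q‖ ^ 2 = 1 := by
  rw [sum_norm_sq_tensorVec, sum_norm_sq_ket, A.advice_unit, one_mul]

theorem dotProduct_tensorVec_ket_of_ne (A : QMachine I O) {z z' : I → Bool} (h : z ≠ z') :
    star (tensorVec (ket z) A.advice) ⬝ᵥ tensorVec (ket z') A.advice = 0 := by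
  refine Finset.sum_eq_zero fun q _ => ?_
  simp only [tensorVec, ket, Pi.single_apply, Pi.star_apply]
  split_ifs with h₁ h₂
  · exact absurd (h₁.symm.trans h₂) h
  all_goals simp

/-- The overlap with `|z⟩|advice⟩` is bounded by the probability of finding `z`. -/
theorem norm_sq_dotProduct_tensorVec_ket_le (A : QMachine I O) (z : I → Bool)
    (φ : (I ⊕ Fin A.anc → Bool) → ℂ) :
    ‖star (tensorVec (ket z) A.advice) ⬝ᵥ φ‖ ^ 2 ≤
      ∑ q, if (fun i => q (Sum.inl i)) = z then ‖φ q‖ ^ 2 else 0 := by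
  have h₁ : ‖star (tensorVec (ket z) A.advice) ⬝ᵥ φ‖ ≤
      ∑ q, ‖tensorVec (ket z) A.advice q‖ *
        if (fun i => q (Sum.inl i)) = z then ‖φ q‖ else 0 := by
    refine (norm_sum_le _ _).trans (Finset.sum_le_sum fun q _ => ?_)
    rw [norm_mul, Pi.star_apply, norm_star]
    split_ifs with h
    · exact le_rfl
    · simp [tensorVec, ket, h]
  -- Cauchy–Schwarz against a unit vector supported on `z`, so only the part of `φ` over `z` is
  -- charged.
  calc _ ≤ _ := pow_le_pow_left₀ (norm_nonneg _) h₁ 2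
    _ ≤ _ := Finset.sum_mul_sq_le_sq_mul_sq _ _ _
    _ = _ := by
      rw [sum_norm_sq_tensorVec_ket_advice, one_mul]
      refine Finset.sum_congr rfl fun q _ => ?_
      split_ifs <;> simp

end QMachine

namespace OTS

variable {S : OTS} {n : ℕ}

/-! ### From a distinguisher to a forger -/

/-- The qubits of the distinguisher. -/
abbrev DistReg (S : OTS) (n a : ℕ) : Type := (S.SigReg n ⊕ S.KeyReg n) ⊕ Fin a

/-- The labels of the advice qubits of the forger: the register `|b, σ⟩` and the first key of the
distinguisher, the advice of the distinguisher, and the message to be signed. -/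
abbrev Workspace (S : OTS) (n a : ℕ) : Type :=
  (S.SigReg n ⊕ Fin (S.vkLen n)) ⊕ (Fin a ⊕ Fin (S.msgLen n))

/-- The number of advice qubits of the forger. -/
abbrev workSize (S : OTS) (n a : ℕ) : ℕ := Fintype.card (Workspace S n a)

/-- The qubits of the forger. -/
abbrev ForgeReg (S : OTS) (n a : ℕ) : Type := S.ForgeIn n ⊕ Fin (workSize S n a)

/-- The advice qubits of the forger, in terms of their labels. -/
noncomputable def workEquiv (S : OTS) (n a : ℕ) : Workspace S n a ≃ Fin (workSize S n a) :=
  Fintype.equivFin _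

/-- The qubits of the forger on which the distinguisher is run; the second key of the
distinguisher is the key that the forger is given. -/
noncomputable def distEmb (S : OTS) (n a : ℕ) : DistReg S n a ↪ ForgeReg S n a where
  toFun
    | .inl (.inl i) => .inr (workEquiv S n a (.inl (.inl i)))
    | .inl (.inr (.inl j)) => .inr (workEquiv S n a (.inl (.inr j)))
    | .inl (.inr (.inr j)) => .inl (.inl j)
    | .inr j => .inr (workEquiv S n a (.inr (.inl j)))
  inj' := by
    rintro ((i | (i | i)) | i) ((j | (j | j)) | j) h <;> simp_all

@[simp] theorem distEmb_sig (a : ℕ) (i : S.SigReg n) :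
    distEmb S n a (.inl (.inl i)) = .inr (workEquiv S n a (.inl (.inl i))) := rfl

@[simp] theorem distEmb_fst_key (a : ℕ) (j : Fin (S.vkLen n)) :
    distEmb S n a (.inl (.inr (.inl j))) = .inr (workEquiv S n a (.inl (.inr j))) := rfl

@[simp] theorem distEmb_snd_key (a : ℕ) (j : Fin (S.vkLen n)) :
    distEmb S n a (.inl (.inr (.inr j))) = .inl (.inl j) := rfl

@[simp] theorem distEmb_anc (a : ℕ) (j : Fin a) :
    distEmb S n a (.inr j) = .inr (workEquiv S n a (.inr (.inl j))) := rfl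

/-- The qubits that the forger measures. -/
noncomputable def forgeOut (S : OTS) (n a : ℕ) : S.ForgeOut n ↪ ForgeReg S n a where
  toFun
    | .inl j => .inr (workEquiv S n a (.inr (.inr j)))
    | .inr j => .inr (workEquiv S n a (.inl (.inl (.inr j))))
  inj' := by
    rintro (i | i) (j | j) h <;> simp_all

@[simp] theorem forgeOut_msg (a : ℕ) (j : Fin (S.msgLen n)) :
    forgeOut S n a (.inl j) = .inr (workEquiv S n a (.inr (.inr j))) := rfl

@[simp] theorem forgeOut_sig (a : ℕ) (j : Fin (S.sigLen n)) :
    forgeOut S n a (.inr j) = .inr (workEquiv S n a (.inl (.inl (.inr j)))) := rfl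

/-- The advice state of the forger, indexed by the labels of the qubits. -/
noncomputable def workState {a : ℕ} (α : BitStr a → ℂ)
    (k : BitStr (S.vkLen n) × BitStr (S.sigLen n))
    (m : BitStr (S.msgLen n)) : (Workspace S n a → Bool) → ℂ :=
  tensorVec (ket (Sum.elim (Sum.elim (fun _ => false) k.2) k.1)) (tensorVec α (ket m))

/-- The forger built from the distinguisher `A`: it holds a pair `k = (vk₀, σ₀)`, applies
the reflection of `A` to `|0, σ₀⟩`, and outputs the message `m` with the resulting signature. -/
noncomputable def forger (A : QMachine (S.SigReg n ⊕ S.KeyReg n) Unit)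
    (k : BitStr (S.vkLen n) × BitStr (S.sigLen n)) (m : BitStr (S.msgLen n)) :
    QMachine (S.ForgeIn n) (S.ForgeOut n) where
  anc := workSize S n A.anc
  advice a := workState A.advice k m (a ∘ workEquiv S n A.anc)
  advice_unit := by
    rw [Fintype.sum_equiv (Equiv.arrowCongr (workEquiv S n A.anc).symm (Equiv.refl Bool))
      (fun a => ‖workState A.advice k m (a ∘ workEquiv S n A.anc)‖ ^ 2)
      (fun a => ‖workState A.advice k m a‖ ^ 2) fun a => rfl, workState, sum_norm_sq_tensorVec,
      sum_norm_sq_tensorVec, sum_norm_sq_ket, sum_norm_sq_ket, A.advice_unit, one_mul, one_mul]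
  circuit := A.reflection.map (Gate.map (distEmb S n A.anc))
  out := forgeOut S n A.anc

theorem size_forger_le (A : QMachine (S.SigReg n ⊕ S.KeyReg n) Unit)
    (k : BitStr (S.vkLen n) × BitStr (S.sigLen n)) (m : BitStr (S.msgLen n)) :
    (forger A k m).size ≤ S.vkLen n + S.skLen n + S.msgLen n + S.sigLen n + 8 * A.size + 5 := by
  have h := A.length_reflection_le
  have h' : workSize S n A.anc = (1 + S.sigLen n + S.vkLen n) + (A.anc + S.msgLen n) := by
    simp [workSize, Workspace, SigReg]
  change workSize S n A.anc + (A.reflection.map (Gate.map (distEmb S n A.anc))).length ≤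
    _ + 8 * (A.anc + A.circuit.length) + 5
  -- The constant 5 is the four `T` gates of the reflection plus the one qubit holding the bit `b`.
  rw [List.length_map]
  omega

/-- The input of the distinguisher that holds `|b, σ⟩` and the keys `vk₀`, `vk₁`. -/
def distIn (b : Bool) (σ : BitStr (S.sigLen n)) (vk₀ vk₁ : BitStr (S.vkLen n)) :
    S.SigReg n ⊕ S.KeyReg n → Bool :=
  Sum.elim (Sum.elim (fun _ => b) σ) (Sum.elim vk₀ vk₁)

/-- The initial basis state of the forger outside the advice of the distinguisher. -/
noncomputable def forgeRef (a : ℕ) (k : BitStr (S.vkLen n) × BitStr (S.sigLen n))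
    (m : BitStr (S.msgLen n)) (x : S.ForgeIn n → Bool) : ForgeReg S n a → Bool :=
  Sum.elim x (Sum.elim (Sum.elim (Sum.elim (fun _ => false) k.2) k.1)
    (Sum.elim (fun _ => false) m) ∘ (workEquiv S n a).symm)

/-- Both sides are the same product of factors, grouped differently: the forger's initial state is
the distinguisher's initial state on the embedded qubits, times fixed basis states elsewhere. -/
theorem tensorVec_forger_advice (A : QMachine (S.SigReg n ⊕ S.KeyReg n) Unit)
    (k : BitStr (S.vkLen n) × BitStr (S.sigLen n)) (m m₀ : BitStr (S.msgLen n))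
    (vk : BitStr (S.vkLen n)) (σ : BitStr (S.sigLen n)) :
    tensorVec (ket (Sum.elim vk (Sum.elim m₀ σ))) (forger A k m).advice =
      embed (distEmb S n A.anc) (forgeRef A.anc k m (Sum.elim vk (Sum.elim m₀ σ)))
        (tensorVec (ket (distIn false k.2 k.1 vk)) A.advice) := by
  -- The untouched qubits are exactly the given pair `(m₀, σ)` and the stored message `m`.
  have hrange : ∀ P : ForgeReg S n A.anc → Prop,
      (∀ j ∉ Set.range (distEmb S n A.anc), P j) ↔
        (∀ j, P (.inl (.inr j))) ∧ ∀ j, P (.inr (workEquiv S n A.anc (.inr (.inr j)))) := by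
    intro P
    constructor
    · refine fun h => ⟨fun j => h _ ?_, fun j => h _ ?_⟩ <;>
      · rintro ⟨(i | (i | i)) | i, hi⟩ <;> simp at hi
    · rintro ⟨h₁, h₂⟩ ((j | j) | j) hj
      · exact absurd ⟨.inl (.inr (.inr j)), rfl⟩ hj
      · exact h₁ j
      · obtain ⟨w, rfl⟩ := (workEquiv S n A.anc).surjective j
        rcases w with (w | w) | (w | w)
        · exact absurd ⟨.inl (.inl w), rfl⟩ hj
        · exact absurd ⟨.inl (.inr (.inl w)), rfl⟩ hj
        · exact absurd ⟨.inr w, rfl⟩ hj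
        · exact h₂ w
  refine funext fun (y : ForgeReg S n A.anc → Bool) => ?_
  have hket : ∀ {Q : Type} [Fintype Q] [DecidableEq Q] (x z : Q → Bool) (c : ℂ)
      [Decidable (∀ j, z j = x j)], (if ∀ j, z j = x j then c else 0) = ket x z * c := by
    intro Q _ _ x z c _
    simp [ket, Pi.single_apply, funext_iff]
  have hR : embed (distEmb S n A.anc) (forgeRef A.anc k m (Sum.elim vk (Sum.elim m₀ σ)))
      (tensorVec (ket (distIn false k.2 k.1 vk)) A.advice) y =
      ket (Sum.elim m₀ σ) (fun j => y (.inl (.inr j))) *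
        (ket m (fun j => y (.inr (workEquiv S n A.anc (.inr (.inr j))))) *
          tensorVec (ket (distIn false k.2 k.1 vk)) A.advice (y ∘ distEmb S n A.anc)) := by
    simp only [embed, hrange, forgeRef, Sum.elim_inl, Sum.elim_inr, Function.comp_apply,
      Equiv.symm_apply_apply, ite_and, hket]
  rw [hR, distIn, ← tensorVec_ket_ket vk, ← tensorVec_ket_ket _ (Sum.elim k.1 vk),
    ← tensorVec_ket_ket k.1]
  change ket vk _ * _ * (ket _ (fun i => y (.inr (workEquiv S n A.anc (.inl i)))) *
    (A.advice (fun j => y (.inr (workEquiv S n A.anc (.inr (.inl j))))) *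
      ket m (fun j => y (.inr (workEquiv S n A.anc (.inr (.inr j))))))) =
    _ * (_ * (ket (Sum.elim (fun _ => false) k.2)
      (fun i => y (.inr (workEquiv S n A.anc (.inl (.inl i))))) *
        (ket k.1 (fun j => y (.inr (workEquiv S n A.anc (.inl (.inr j))))) *
          ket vk (fun j => y (.inl (.inl j)))) *
            A.advice (fun j => y (.inr (workEquiv S n A.anc (.inr (.inl j)))))))
  rw [← tensorVec_ket_ket _ k.1]
  have hcomm : ∀ a b c d e f : ℂ, a * b * (c * d * (e * f)) = b * (f * (c * (d * a) * e)) := by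
    intros; ring
  exact hcomm _ _ _ _ _ _

theorem extend_forgeOut (a : ℕ) (k : BitStr (S.vkLen n) × BitStr (S.sigLen n))
    (m : BitStr (S.msgLen n)) (x : S.ForgeIn n → Bool) (q : DistReg S n a → Bool)
    {b : Bool} {σ : BitStr (S.sigLen n)} {vk₀ vk₁ : BitStr (S.vkLen n)}
    (hq : (fun i => q (Sum.inl i)) = distIn b σ vk₀ vk₁) :
    (fun o => Function.extend (distEmb S n a) q (forgeRef a k m x) (forgeOut S n a o)) =
      Sum.elim m σ := by
  funext o
  rcases o with j | j
  · rw [Function.extend_apply']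
    · simp [forgeRef]
    · rintro ⟨(i | (i | i)) | i, hi⟩ <;> simp at hi
  · have h : forgeOut S n a (.inr j) = distEmb S n a (.inl (.inl (.inr j))) := rfl
    rw [h, (distEmb S n a).injective.extend_apply]
    exact congrFun hq (.inl (.inr j))

/-- The overlap of the reflected state with `|1, σ⟩`. -/
noncomputable def overlap (A : QMachine (S.SigReg n ⊕ S.KeyReg n) Unit)
    (k₀ k₁ : BitStr (S.vkLen n) × BitStr (S.sigLen n)) : ℂ :=
  star (tensorVec (ket (distIn true k₁.2 k₀.1 k₁.1)) A.advice) ⬝ᵥ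
    (circuitUnitary A.reflection *ᵥ tensorVec (ket (distIn false k₀.2 k₀.1 k₁.1)) A.advice)

/-- The forger runs the reflection on its embedded register, and every outcome in which that
register's input part reads `|1,σ₁⟩` with keys `vk₀`, `vk₁` makes it output `(m, σ₁)`. -/
theorem norm_overlap_sq_le_outProb (A : QMachine (S.SigReg n ⊕ S.KeyReg n) Unit)
    (k₀ k₁ : BitStr (S.vkLen n) × BitStr (S.sigLen n)) (m m₀ : BitStr (S.msgLen n))
    (σ : BitStr (S.sigLen n)) :
    ‖overlap A k₀ k₁‖ ^ 2 ≤ (forger A k₀ m).outProb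
      (proj (ket (Sum.elim k₁.1 (Sum.elim m₀ σ)))) (Sum.elim m k₁.2) := by
  set φ := circuitUnitary A.reflection *ᵥ tensorVec (ket (distIn false k₀.2 k₀.1 k₁.1)) A.advice
  set r := forgeRef A.anc k₀ m (Sum.elim k₁.1 (Sum.elim m₀ σ))
  have hfinal : (forger A k₀ m).finalVec (ket (Sum.elim k₁.1 (Sum.elim m₀ σ))) =
      embed (distEmb S n A.anc) r φ := by
    rw [QMachine.finalVec, tensorVec_forger_advice]
    exact circuitUnitary_map_mulVec_embed _ _ _ _
  refine (A.norm_sq_dotProduct_tensorVec_ket_le _ φ).trans ?_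
  rw [QMachine.outProb_proj, hfinal]
  -- Extending by `r` injects the distinguisher's basis states into the forger's, preserving
  -- amplitudes; the forger's remaining outcomes only add nonnegative terms.
  have hinj : Function.Injective fun q => Function.extend (distEmb S n A.anc) q r :=
    Function.extend_injective (distEmb S n A.anc).injective r
  refine (Finset.sum_le_sum fun q _ => ?_).trans ((Finset.sum_map Finset.univ ⟨_, hinj⟩
    (fun x => if (fun o => x (forgeOut S n A.anc o)) = Sum.elim m k₁.2 then
      ‖embed (distEmb S n A.anc) r φ x‖ ^ 2 else 0)).symm.le.trans
    (Finset.sum_le_univ_sum_of_nonneg fun x => ?_))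
  · by_cases hq : (fun i => q (Sum.inl i)) = distIn true k₁.2 k₀.1 k₁.1
    · rw [if_pos hq, Function.Embedding.coeFn_mk, if_pos (extend_forgeOut _ _ _ _ _ hq),
        embed_extend]
    · rw [if_neg hq]
      split_ifs <;> positivity
  · split_ifs <;> positivity

/-! ### The gap for fixed keys and signatures. -/

theorem tensor_superposition (σ₀ σ₁ : BitStr (S.sigLen n)) (vk₀ vk₁ : BitStr (S.vkLen n)) :
    tensor (S.superposition n σ₀ σ₁) (proj (ket (Sum.elim vk₀ vk₁))) =
      proj (((1 / Real.sqrt 2 : ℝ) : ℂ) •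
        (ket (distIn false σ₀ vk₀ vk₁) + ket (distIn true σ₁ vk₀ vk₁))) := by
  rw [superposition, tensor_proj_proj, tensorVec_smul_left, tensorVec_add_left, sigKet, sigKet,
    tensorVec_ket_ket, tensorVec_ket_ket, distIn, distIn]

theorem tensor_mixture (σ₀ σ₁ : BitStr (S.sigLen n)) (vk₀ vk₁ : BitStr (S.vkLen n)) :
    tensor (S.mixture n σ₀ σ₁) (proj (ket (Sum.elim vk₀ vk₁))) =
      (1 / 2 : ℂ) •
        (proj (ket (distIn false σ₀ vk₀ vk₁)) + proj (ket (distIn true σ₁ vk₀ vk₁))) := by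
  rw [mixture, tensor_smul_left, tensor_add_left, tensor_proj_proj, tensor_proj_proj, sigKet,
    sigKet, tensorVec_ket_ket, tensorVec_ket_ket, distIn, distIn]

theorem abs_outProb_sub_le_norm_overlap (A : QMachine (S.SigReg n ⊕ S.KeyReg n) Unit)
    (k₀ k₁ : BitStr (S.vkLen n) × BitStr (S.sigLen n)) :
    |A.outProb (tensor (S.superposition n k₀.2 k₁.2) (proj (ket (Sum.elim k₀.1 k₁.1))))
        (fun _ => true) -
      A.outProb (tensor (S.mixture n k₀.2 k₁.2) (proj (ket (Sum.elim k₀.1 k₁.1))))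
        (fun _ => true)| ≤ ‖overlap A k₀ k₁‖ := by
  have hne : distIn true k₁.2 k₀.1 k₁.1 ≠ distIn false k₀.2 k₀.1 k₁.1 := fun h =>
    Bool.noConfusion (congrFun h (.inl (.inl ())))
  rw [tensor_superposition, tensor_mixture, QMachine.outProb_superposition_sub_mixture, overlap,
    A.dotProduct_reflection _ _ (A.dotProduct_tensorVec_ket_of_ne hne), norm_mul, norm_neg,
    Complex.norm_two]
  -- The overlap is twice the interference term in norm; the factor 2 is given away.
  refine (Complex.abs_re_le_norm _).trans ?_
  linarith [norm_nonneg (star (A.finalVec (ket (distIn true k₁.2 k₀.1 k₁.1))) ⬝ᵥ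
    ((A.outcome fun _ => true) *ᵥ A.finalVec (ket (distIn false k₀.2 k₀.1 k₁.1))))]

end OTS

/-! ### Finite probability -/

theorem sum_toReal_pmf {α : Type*} [Fintype α] (p : PMF α) : ∑ a, (p a).toReal = 1 := by
  rw [← ENNReal.toReal_sum fun a _ => p.apply_ne_top a, ← tsum_fintype (L := .unconditional α),
    p.tsum_coe,
    ENNReal.toReal_one]

theorem sum_toReal_map_mul {α β : Type*} [Fintype α] [Fintype β] (p : PMF α) (f : α → β)
    (h : β → ℝ) : ∑ b, (p.map f b).toReal * h b = ∑ a, (p a).toReal * h (f a) := by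
  classical
  have key : ∀ b, (p.map f b).toReal = ∑ a, if b = f a then (p a).toReal else 0 := by
    intro b
    rw [PMF.map_apply, tsum_fintype, ENNReal.toReal_sum]
    · refine Finset.sum_congr rfl fun a _ => ?_
      split_ifs <;> rfl
    · intro a _
      split_ifs
      · exact p.apply_ne_top a
      · exact ENNReal.zero_ne_top
  simp only [key, Finset.sum_mul]
  rw [Finset.sum_comm]
  simp [ite_mul]

theorem sq_sum_toReal_mul_le {α : Type*} [Fintype α] (p : PMF α) (f : α → ℝ)
    (hf : ∀ a, 0 ≤ f a) :
    (∑ a, (p a).toReal * f a) ^ 2 ≤ ∑ a, (p a).toReal * f a ^ 2 :=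
  Real.pow_arith_mean_le_arith_mean_pow Finset.univ _ _ (fun _ _ => ENNReal.toReal_nonneg)
    (sum_toReal_pmf p) (fun a _ => hf a) 2

theorem exists_sum_toReal_mul_le {α : Type*} [Fintype α] (p : PMF α) (f : α → ℝ) :
    ∃ a, ∑ b, (p b).toReal * f b ≤ f a := by
  have : Nonempty α := p.support_nonempty.to_subtype.map Subtype.val
  obtain ⟨a, ha⟩ := Finite.exists_max f
  refine ⟨a, ?_⟩
  calc ∑ b, (p b).toReal * f b ≤ ∑ b, (p b).toReal * f a :=
        Finset.sum_le_sum fun b _ => mul_le_mul_of_nonneg_left (ha b) ENNReal.toReal_nonneg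
    _ = f a := by rw [← Finset.sum_mul, sum_toReal_pmf, one_mul]

/-- Decay of `ν` at exponent `2k` controls `(n ^ k * f n) ^ 2`; take square roots. -/
theorem Negligible.of_sq_le {f ν : ℕ → ℝ} (hν : Negligible ν) (h : ∀ n, f n ^ 2 ≤ ν n) :
    Negligible f := by
  intro k
  have h₁ : Filter.Tendsto (fun n : ℕ => ((n : ℝ) ^ k * f n) ^ 2) Filter.atTop (nhds 0) := by
    refine squeeze_zero (fun n => sq_nonneg _) (fun n => ?_) (hν (k * 2))
    rw [mul_pow, ← pow_mul]
    exact mul_le_mul_of_nonneg_left (h n) (by positivity)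
  have h₂ := h₁.sqrt
  simp only [Real.sqrt_sq_eq_abs, Real.sqrt_zero] at h₂
  exact (tendsto_zero_iff_abs_tendsto_zero _).2 h₂

namespace QMachine

theorem outProb_proj_nonneg {I O : Type} [Fintype I] [DecidableEq I] [Fintype O] [DecidableEq O]
    (A : QMachine I O) (χ : (I → Bool) → ℂ) (y : O → Bool) : 0 ≤ A.outProb (proj χ) y := by
  rw [outProb_proj]
  exact Finset.sum_nonneg fun x _ => by split_ifs <;> positivity

end QMachine

namespace OTS

variable {S : OTS} {n : ℕ}

/-! ### The reduction -/

/-- The key is drawn before the message is used. This lets the challenge key, which comes with a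
signature on `m₀`, play the role of a key that signed `m`. -/
theorem map_fst_signed (m : BitStr (S.msgLen n)) :
    (S.signed n m).map Prod.fst = (S.gen n).map Prod.fst := by
  rw [signed, PMF.map_bind, ← PMF.bind_pure_comp]
  congr 1
  funext k
  rw [PMF.map_comp]
  exact PMF.map_const _ _

theorem sum_signed_mul_fst (m m' : BitStr (S.msgLen n)) (h : BitStr (S.vkLen n) → ℝ) :
    ∑ k, (S.signed n m k).toReal * h k.1 = ∑ k, (S.signed n m' k).toReal * h k.1 := by
  rw [← sum_toReal_map_mul _ Prod.fst, ← sum_toReal_map_mul _ Prod.fst, map_fst_signed,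
    map_fst_signed]

/-- The support of a mixture is the union of the supports of its components, so a mixture
concentrated on `true` has every component concentrated there. -/
theorem Correct.ver_eq_one (hS : S.Correct) {m : BitStr (S.msgLen n)}
    {k : BitStr (S.vkLen n) × BitStr (S.sigLen n)} (hk : S.signed n m k ≠ 0) :
    S.ver n k.1 m k.2 true = 1 := by
  have h₁ : ((S.signed n m).bind fun k => S.ver n k.1 m k.2) true = 1 := by
    rw [← hS n m, signed, PMF.bind_bind]
    congr 2
    funext k
    rw [PMF.bind_map]
    rfl
  rw [PMF.apply_eq_one_iff, PMF.support_bind] at h₁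
  rw [PMF.apply_eq_one_iff]
  refine (PMF.support_nonempty _).subset_singleton_iff.1 ?_
  rw [← h₁]
  exact Set.subset_biUnion_of_mem (u := fun k => (S.ver n k.1 m k.2).support)
    ((PMF.mem_support_iff _ _).2 hk)

theorem sum_norm_overlap_sq_le_forgeProb (hS : S.Correct)
    (A : QMachine (S.SigReg n ⊕ S.KeyReg n) Unit)
    (k₀ : BitStr (S.vkLen n) × BitStr (S.sigLen n)) {m m₀ : BitStr (S.msgLen n)} (hm : m ≠ m₀) :
    ∑ k, (S.signed n m k).toReal * ‖overlap A k₀ k‖ ^ 2 ≤ S.forgeProb n (forger A k₀ m) m₀ := by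
  -- Summing over all `σ`, weighted by acceptance, gives a quantity depending on `vk` alone, so the
  -- key marginals can be exchanged; the honest `σ` is one of its terms.
  set h : BitStr (S.vkLen n) → ℝ := fun vk =>
    ∑ σ, ‖overlap A k₀ (vk, σ)‖ ^ 2 * (S.ver n vk m σ true).toReal
  have hterm : ∀ vk σ, 0 ≤ ‖overlap A k₀ (vk, σ)‖ ^ 2 * (S.ver n vk m σ true).toReal :=
    fun vk σ => mul_nonneg (by positivity) ENNReal.toReal_nonneg
  calc ∑ k, (S.signed n m k).toReal * ‖overlap A k₀ k‖ ^ 2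
      ≤ ∑ k, (S.signed n m k).toReal * h k.1 := by
        refine Finset.sum_le_sum fun k _ => ?_
        by_cases hk : S.signed n m k = 0
        · simp [hk]
        · refine mul_le_mul_of_nonneg_left ?_ ENNReal.toReal_nonneg
          have := Finset.single_le_sum (fun σ _ => hterm k.1 σ) (Finset.mem_univ k.2)
          simpa only [hS.ver_eq_one hk, ENNReal.toReal_one, mul_one] using this
    _ = ∑ k, (S.signed n m₀ k).toReal * h k.1 := sum_signed_mul_fst m m₀ h
    _ ≤ S.forgeProb n (forger A k₀ m) m₀ := by
        refine Finset.sum_le_sum fun k _ => mul_le_mul_of_nonneg_left ?_ ENNReal.toReal_nonneg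
        rw [Fintype.sum_prod_type]
        refine le_trans ?_ (Finset.single_le_sum (fun m' _ => ?_) (Finset.mem_univ m))
        · refine Finset.sum_le_sum fun σ _ => ?_
          -- The output message differs from the signed one, so the winning condition never discards
          -- it.
          rw [if_neg fun he => hm (congrArg Prod.fst he)]
          exact mul_le_mul_of_nonneg_right
            (norm_overlap_sq_le_outProb A k₀ (k.1, σ) m m₀ k.2) ENNReal.toReal_nonneg
        · refine Finset.sum_nonneg fun σ _ => ?_
          split_ifs
          · exact le_rfl
          · exact mul_nonneg (QMachine.outProb_proj_nonneg _ _ _) ENNReal.toReal_nonneg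

theorem outProb_ensemble (bit : ∀ n, Bool ↪ BitStr (S.msgLen n))
    (ρ : ∀ n, BitStr (S.sigLen n) → BitStr (S.sigLen n) → Op (S.SigReg n))
    (A : QMachine (S.SigReg n ⊕ S.KeyReg n) Unit) (y : Unit → Bool) :
    A.outProb (S.ensemble bit ρ n) y =
      ∑ k₀, (S.signed n (bit n false) k₀).toReal * ∑ k₁, (S.signed n (bit n true) k₁).toReal *
        A.outProb (tensor (ρ n k₀.2 k₁.2) (proj (ket (Sum.elim k₀.1 k₁.1)))) y := by
  simp only [ensemble, QMachine.outProb_sum, QMachine.outProb_smul, Finset.mul_sum, mul_assoc]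

/-- The distinguishing advantage is bounded by the success probability of a forger. -/
theorem exists_sq_advantage_le_forgeProb (hS : S.Correct)
    (bit : ∀ n, Bool ↪ BitStr (S.msgLen n)) (A : QMachine (S.SigReg n ⊕ S.KeyReg n) Unit) :
    ∃ k₀ : BitStr (S.vkLen n) × BitStr (S.sigLen n),
      |A.outProb (S.ensemble bit S.superposition n) (fun _ => true) -
        A.outProb (S.ensemble bit S.mixture n) (fun _ => true)| ^ 2 ≤
      S.forgeProb n (forger A k₀ (bit n true)) (bit n false) := by
  -- Non-uniformity: a best `(vk₀, σ₀)` becomes advice, so no sampling is needed and Jensen is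
  -- applied only to `k₁`.
  obtain ⟨k₀, hk₀⟩ := exists_sum_toReal_mul_le (S.signed n (bit n false)) fun k₀ =>
    ∑ k₁, (S.signed n (bit n true) k₁).toReal * ‖overlap A k₀ k₁‖
  refine ⟨k₀, le_trans ?_ ((sq_sum_toReal_mul_le (S.signed n (bit n true))
    (fun k => ‖overlap A k₀ k‖) fun _ => norm_nonneg _).trans
      (sum_norm_overlap_sq_le_forgeProb hS A k₀ ((bit n).injective.ne (by decide))))⟩
  refine pow_le_pow_left₀ (abs_nonneg _) (le_trans ?_ hk₀) 2
  have habs : ∀ (p : PMF (BitStr (S.vkLen n) × BitStr (S.sigLen n))) (f g h : _ → ℝ),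
      (∀ k, |f k - g k| ≤ h k) →
        |∑ k, (p k).toReal * f k - ∑ k, (p k).toReal * g k| ≤ ∑ k, (p k).toReal * h k := by
    intro p f g h hfg
    rw [← Finset.sum_sub_distrib]
    refine (Finset.abs_sum_le_sum_abs _ _).trans (Finset.sum_le_sum fun k _ => ?_)
    rw [← mul_sub, abs_mul, abs_of_nonneg ENNReal.toReal_nonneg]
    exact mul_le_mul_of_nonneg_left (hfg k) ENNReal.toReal_nonneg
  rw [outProb_ensemble, outProb_ensemble]
  exact habs _ _ _ _ fun k₀ => habs _ _ _ _ fun k₁ => abs_outProb_sub_le_norm_overlap A k₀ k₁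

end OTS

end QOTS

/-! ### Asymptotic conclusion. -/

theorem mainTheorem4 (S : QOTS.OTS) (hcorrect : S.Correct) (hunf : S.StronglyUnforgeable)
    (bit : ∀ n, Bool ↪ QOTS.BitStr (S.msgLen n)) :
    QOTS.CompIndist (Q := fun n => S.SigReg n ⊕ S.KeyReg n)
      (S.ensemble bit S.superposition) (S.ensemble bit S.mixture) := by
  rintro A ⟨p, hp⟩
  choose k₀ hk₀ using fun n => QOTS.OTS.exists_sq_advantage_le_forgeProb hcorrect bit (A n)
  obtain ⟨q, hq⟩ := S.poly_len
  obtain ⟨ν, hν, hforge⟩ := hunf (fun n => QOTS.OTS.forger (A n) (k₀ n) (bit n true))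
    ⟨q + 8 * p + 5, fun n => by
      have h₁ := QOTS.OTS.size_forger_le (A n) (k₀ n) (bit n true)
      have h₂ := hp n
      have h₃ := hq n
      simp only [Polynomial.eval_add, Polynomial.eval_mul, Polynomial.eval_ofNat]
      omega⟩
  exact hν.of_sq_le fun n => (hk₀ n).trans (hforge n (bit n false))
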